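/- **Theorem 3.4.** Every quasi-Polish space is a convergent approximation space. Here a *quasi-metric* on a set $E$ is a function $d:E\times E\to[0,+\infty)$ such that, for all $x,y,z\in E$, $x=y\Leftrightarrow d(x,y)=d(y,x)=0$ and $d(x,z)\le d(x,y)+d(y,z)$. Its associated topology is the one generated by the open balls $\{y\in E : d(x,y)<r\}$ with $x\in E$ and $r>0$. A sequence $(x_n)_{n\in\mathbb N}$ is *Cauchy* if $\lim_{n\to\infty}\sup_{p\ge n}d(x_n,x_p)=0$, and $d$ is *complete* if every Cauchy sequence converges with respect to the metric $\widehat d(x,y)=\max\{d(x,y),d(y,x)\}$. A topological space is *quasi-Polish* if it has a countable topological basis and its topology is associated to some complete quasi-metric. A topological space $E$ is a *convergent approximation space* if there are a topological basis $\mathcal B$ of $E$ and a binary relation $\ll$ on $\mathcal B$ such that, for all $U,V,T\in\mathcal B$: 1. if $U\ll V$ then $V\subseteq U$; 2. if $U\subseteq T$ and $U\ll V$ then $T\ll V$; 3. for every $x\in U$ there is $W\in\mathcal B$ with $x\in W$ and $U\ll W$; 4. for every sequence $(U_i)_{i\in\mathbb N}$ in $\mathcal B$ with $U_i\ll U_{i+1}$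 for all $i$, there is a point $x\in\bigcap_{i\in\mathbb N}U_i$ such that every open set containing $x$ contains some $U_i$. -/

import Mathlib

open Filter Topology

/-- A quasi-metric on `E`: a function `d : E × E → [0, ∞)` satisfying the triangle inequality and
`x = y ↔ d x y = d y x = 0`; symmetry is not required. -/
structure IsQuasiMetric {E : Type*} (d : E → E → ℝ) : Prop where
  nonneg : ∀ x y, 0 ≤ d x y
  eq_iff : ∀ x y, x = y ↔ d x y = 0 ∧ d y x = 0
  triangle : ∀ x y z, d x z ≤ d x y + d y z

/-- The topology associated to a quasi-metric: the one generated by the open balls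
`{y | d x y < r}`, `r > 0`. -/
abbrev quasiMetricTopology {E : Type*} (d : E → E → ℝ) : TopologicalSpace E :=
  TopologicalSpace.generateFrom {B | ∃ (x : E) (r : ℝ), 0 < r ∧ B = {y | d x y < r}}

/-- A sequence is Cauchy for a quasi-metric if `sup_{p ≥ n} d (u n) (u p)` tends to `0` as `n`
tends to infinity. -/
def IsQuasiCauchySeq {E : Type*} (d : E → E → ℝ) (u : ℕ → E) : Prop :=
  ∀ ε : ℝ, 0 < ε → ∃ N : ℕ, ∀ n p : ℕ, N ≤ n → n ≤ p → d (u n) (u p) < ε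

/-- A quasi-metric is complete if every Cauchy sequence converges for the metric
`max (d x y) (d y x)`. -/
def IsCompleteQuasiMetric {E : Type*} (d : E → E → ℝ) : Prop :=
  ∀ u : ℕ → E, IsQuasiCauchySeq d u →
    ∃ x : E, Tendsto (fun n => max (d (u n) x) (d x (u n))) atTop (𝓝 0)

/-- A quasi-Polish space: a topological space with a countable basis whose topology is
associated to some complete quasi-metric. -/
def IsQuasiPolishSpace (E : Type*) [t : TopologicalSpace E] : Prop :=
  SecondCountableTopology E ∧
    ∃ d : E → E → ℝ, IsQuasiMetric d ∧ IsCompleteQuasiMetric d ∧ t = quasiMetricTopology d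

/-- `R` (restricted to members of `B`) is an approximation relation on the topological
basis `B` of `E`. -/
structure IsApproximationRelation {E : Type*} [TopologicalSpace E]
    (B : Set (Set E)) (R : Set E → Set E → Prop) : Prop where
  isBasis : TopologicalSpace.IsTopologicalBasis B
  subset : ∀ U ∈ B, ∀ V ∈ B, R U V → V ⊆ U
  mono_left : ∀ U ∈ B, ∀ V ∈ B, ∀ T ∈ B, U ⊆ T → R U V → R T V
  exists_rel : ∀ U ∈ B, ∀ x ∈ U, ∃ W ∈ B, x ∈ W ∧ R U W
  nonempty_iInter : ∀ U : ℕ → Set E, (∀ i, U i ∈ B) → (∀ i, R (U i) (U (i + 1))) →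
    (⋂ i, U i).Nonempty

/-- A convergent approximation relation: every infinite `R`-chain of members of `B` is moreover
a neighborhood basis of some point of its intersection. -/
structure IsConvergentApproximationRelation {E : Type*} [TopologicalSpace E]
    (B : Set (Set E)) (R : Set E → Set E → Prop) : Prop
    extends IsApproximationRelation B R where
  convergent : ∀ U : ℕ → Set E, (∀ i, U i ∈ B) → (∀ i, R (U i) (U (i + 1))) →
    ∃ x ∈ ⋂ i, U i, ∀ O : Set E, IsOpen O → x ∈ O → ∃ i, U i ⊆ O

/-- A convergent approximation space: a space admitting a convergent approximation relation
on some topological basis. -/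
def IsConvergentApproximationSpace (E : Type*) [TopologicalSpace E] : Prop :=
  ∃ (B : Set (Set E)) (R : Set E → Set E → Prop), IsConvergentApproximationRelation B R

/-!
Fix a complete quasi-metric `d` inducing the topology, a countable basis `B`, and an injective
rank `f : B → ℕ`. Declare `U ≪ V` when there are a member `W ⊆ U` of `B` and a ball with
`V ⊆ {y | d x y < r} ⊆ {y | d x y ≤ r} ⊆ W` and `r ≤ 1 / (f W + 1)`, subject to the proviso that
`V = W` is allowed only when `W` is the smallest neighborhood of one of its points
(`IsRankedApproximation`). The bound on the radius refers to the rank of the intermediate set `W`,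
not of `U`, so monotonicity in `U` is automatic; on the other hand, given `x ∈ U`, one can always
take `W = U`.

A chain `U 0 ≪ U 1 ≪ ⋯` interleaves with its intermediate sets: `U i ⊇ W i ⊇ U (i + 1)`.

* If `W` is eventually constant, then so is `U`, with the same value. The proviso then provides a
  point of which this value is the smallest neighborhood, and the chain converges to it.
* Otherwise each member of `B` occurs only finitely often among the `W i`, so their ranks tend to
  infinity (`tendsto_rank_atTop`) and the radii tend to zero. The centers form a Cauchy sequence
  because all later centers lie in the `i`-th ball, and their limit is the required point
  (`exists_limit_of_nested_balls`).
-/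

theorem isOpen_quasiBall {E : Type*} [t : TopologicalSpace E] {d : E → E → ℝ}
    (ht : t = quasiMetricTopology d) (x : E) {r : ℝ} (hr : 0 < r) :
    IsOpen {y | d x y < r} := by
  subst ht
  exact TopologicalSpace.isOpen_generateFrom_of_mem ⟨x, r, hr, rfl⟩

theorem exists_quasiBall_subset {E : Type*} [t : TopologicalSpace E] {d : E → E → ℝ}
    (hd : IsQuasiMetric d) (ht : t = quasiMetricTopology d) {O : Set E} (hO : IsOpen O)
    {x : E} (hx : x ∈ O) : ∃ ε > 0, {y | d x y < ε} ⊆ O := by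
  subst ht
  change TopologicalSpace.GenerateOpen _ O at hO
  induction hO with
  | basic s hs =>
    obtain ⟨c, r, -, rfl⟩ := hs
    refine ⟨r - d c x, sub_pos.2 hx, fun y hy => ?_⟩
    have h1 := hd.triangle c x y
    simp only [Set.mem_ofPred_eq] at hy ⊢
    linarith
  | univ => exact ⟨1, one_pos, Set.subset_univ _⟩
  | inter s u _ _ hs hu =>
    obtain ⟨a, ha, hsa⟩ := hs hx.1
    obtain ⟨b, hb, hub⟩ := hu hx.2
    exact ⟨min a b, lt_min ha hb, fun y (hy : d x y < min a b) =>
      ⟨hsa (hy.trans_le (min_le_left _ _)), hub (hy.trans_le (min_le_right _ _))⟩⟩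
  | sUnion S _ ih =>
    obtain ⟨s, hs, hxs⟩ := hx
    obtain ⟨ε, hε, h⟩ := ih s hs hxs
    exact ⟨ε, hε, h.trans (Set.subset_sUnion_of_mem hs)⟩

/-- The limit is located in the sets `{y | d (c i) y ≤ r i}`, with a non-strict inequality, since
the bound `d (c i) (c p) < r i` only passes to the limit in that form. -/
theorem exists_limit_of_nested_balls {E : Type*} [t : TopologicalSpace E] {d : E → E → ℝ}
    (hd : IsQuasiMetric d) (hc : IsCompleteQuasiMetric d) (ht : t = quasiMetricTopology d)
    {c : ℕ → E} {r : ℕ → ℝ} (hr0 : Tendsto r atTop (𝓝 0))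
    (hcr : ∀ i p, i < p → d (c i) (c p) < r i) :
    ∃ x, (∀ i, d (c i) x ≤ r i) ∧
      ∀ O : Set E, IsOpen O → x ∈ O → ∃ i, {y | d (c i) y < r i} ⊆ O := by
  have hcauchy : IsQuasiCauchySeq d c := by
    intro ε hε
    obtain ⟨N, hN⟩ := eventually_atTop.1 (hr0.eventually_lt_const hε)
    refine ⟨N, fun n p hn hnp => ?_⟩
    rcases hnp.eq_or_lt with rfl | h
    · rwa [((hd.eq_iff (c n) (c n)).1 rfl).1]
    · exact (hcr n p h).trans (hN n hn)
  obtain ⟨x, hx⟩ := hc c hcauchy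
  refine ⟨x, fun i => ?_, fun O hO hxO => ?_⟩
  · refine le_of_forall_pos_lt_add fun ε hε => ?_
    obtain ⟨p, hp, hip⟩ := ((hx.eventually_lt_const hε).and (eventually_gt_atTop i)).exists
    have h1 := hd.triangle (c i) (c p) x
    have h2 := hcr i p hip
    have h3 := (max_lt_iff.1 hp).1
    linarith
  · obtain ⟨ε, hε, hεO⟩ := exists_quasiBall_subset hd ht hO hxO
    obtain ⟨i, h1, h2⟩ := ((hx.eventually_lt_const (half_pos hε)).and
      (hr0.eventually_lt_const (half_pos hε))).exists
    refine ⟨i, fun y hy => hεO ?_⟩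
    have h3 := hd.triangle x (c i) y
    have h4 := (max_lt_iff.1 h1).2
    simp only [Set.mem_ofPred_eq] at hy ⊢
    linarith

theorem tendsto_rank_atTop {E : Type*} {B : Set (Set E)} {f : Set E → ℕ} (hf : Set.InjOn f B)
    {W : ℕ → Set E} (hWB : ∀ i, W i ∈ B) (hW : Antitone W)
    (hne : ∀ N, ∃ i ≥ N, W i ≠ W N) : Tendsto (fun i => f (W i)) atTop atTop := by
  rw [← Nat.cofinite_eq_atTop]
  refine Filter.Tendsto.cofinite_of_finite_preimage_singleton fun k => ?_
  rcases Set.eq_empty_or_nonempty ((fun i => f (W i)) ⁻¹' {k}) with h | ⟨N, hN⟩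
  · exact h ▸ Set.finite_empty
  · obtain ⟨j, hj, hjN⟩ := hne N
    refine (Set.finite_Iio j).subset fun i hi => ?_
    by_contra hij
    -- A value that reappears at `i ≥ j` would be squeezed onto `W j`.
    have hiN : W i = W N := hf (hWB i) (hWB N) (hi.trans hN.symm)
    exact hjN ((hW hj).antisymm (hiN ▸ hW (not_lt.1 hij)))

/-- `V` is contained in a ball whose closed version lies in `W` and whose radius is at most
`1 / (f W + 1)`; moreover `V` may equal `W` only if `W` is contained in every open set around one
of its points. -/
def IsRankedApproximation {E : Type*} [TopologicalSpace E] (d : E → E → ℝ) (f : Set E → ℕ)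
    (W V : Set E) : Prop :=
  (∃ (x : E) (r : ℝ), 0 < r ∧ r ≤ 1 / ((f W : ℝ) + 1) ∧ {y | d x y ≤ r} ⊆ W ∧
    V ⊆ {y | d x y < r}) ∧
  (V = W → ∃ x ∈ W, ∀ O : Set E, IsOpen O → x ∈ O → W ⊆ O)

theorem IsRankedApproximation.subset {E : Type*} [TopologicalSpace E] {d : E → E → ℝ}
    {f : Set E → ℕ} {W V : Set E} (h : IsRankedApproximation d f W V) : V ⊆ W := by
  obtain ⟨⟨x, r, -, -, h1, h2⟩, -⟩ := h
  exact h2.trans fun y (hy : d x y < r) => h1 hy.le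

theorem exists_isRankedApproximation {E : Type*} [t : TopologicalSpace E] {d : E → E → ℝ}
    (hd : IsQuasiMetric d) (ht : t = quasiMetricTopology d) {B : Set (Set E)}
    (hB : TopologicalSpace.IsTopologicalBasis B) (f : Set E → ℕ) {U : Set E} (hU : U ∈ B)
    {x : E} (hx : x ∈ U) : ∃ V ∈ B, x ∈ V ∧ IsRankedApproximation d f U V := by
  obtain ⟨ε, hε, hεU⟩ := exists_quasiBall_subset hd ht (hB.isOpen hU) hx
  set r := min (ε / 2) (1 / ((f U : ℝ) + 1))
  have hr0 : 0 < r := by positivity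
  have hrU : {y | d x y ≤ r} ⊆ U := fun y (hy : d x y ≤ r) => hεU <| by
    have := min_le_left (ε / 2) (1 / ((f U : ℝ) + 1))
    simp only [Set.mem_ofPred_eq]
    linarith
  have hxr : x ∈ {y | d x y < r} := by
    simpa [((hd.eq_iff x x).1 rfl).1] using hr0
  by_cases hmin : ∀ O : Set E, IsOpen O → x ∈ O → U ⊆ O
  · exact ⟨U, hU, hx, ⟨x, r, hr0, min_le_right _ _, hrU,
      hmin _ (isOpen_quasiBall ht x hr0) hxr⟩, fun _ => ⟨x, hx, hmin⟩⟩
  · push Not at hmin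
    obtain ⟨O, hO, hxO, hUO⟩ := hmin
    obtain ⟨V, hV, hxV, hVO⟩ := hB.exists_subset_of_mem_open (Set.mem_inter hxr hxO)
      ((isOpen_quasiBall ht x hr0).inter hO)
    exact ⟨V, hV, hxV, ⟨x, r, hr0, min_le_right _ _, hrU, hVO.trans Set.inter_subset_left⟩,
      fun h => absurd (h ▸ hVO.trans Set.inter_subset_right) hUO⟩

theorem exists_limit_of_rankedApproximation_chain {E : Type*} [t : TopologicalSpace E]
    {d : E → E → ℝ} (hd : IsQuasiMetric d) (hc : IsCompleteQuasiMetric d)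
    (ht : t = quasiMetricTopology d) {B : Set (Set E)} {f : Set E → ℕ} (hf : Set.InjOn f B)
    {U W : ℕ → Set E} (hWB : ∀ i, W i ∈ B) (hWU : ∀ i, W i ⊆ U i)
    (hR : ∀ i, IsRankedApproximation d f (W i) (U (i + 1))) :
    ∃ x ∈ ⋂ i, U i, ∀ O : Set E, IsOpen O → x ∈ O → ∃ i, U i ⊆ O := by
  have hW : Antitone W := antitone_nat_of_succ_le fun i => (hWU _).trans (hR i).subset
  by_cases hconst : ∃ N, ∀ i ≥ N, W i = W N
  · obtain ⟨N, hN⟩ := hconst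
    have hUN : U (N + 1) = W N :=
      (hR N).subset.antisymm (hN (N + 1) N.le_succ ▸ hWU (N + 1))
    obtain ⟨x, hx, hmin⟩ := (hR N).2 hUN
    refine ⟨x, Set.mem_iInter.2 fun i => hWU i ?_, fun O hO hxO => ⟨N + 1, ?_⟩⟩
    · rcases le_total i N with h | h
      · exact hW h hx
      · rwa [hN i h]
    · exact hUN ▸ hmin O hO hxO
  · push Not at hconst
    have hrank := tendsto_rank_atTop hf hWB hW hconst
    choose c r hr0 hr hcW hcU using fun i => (hR i).1
    have hrlim : Tendsto r atTop (𝓝 0) :=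
      squeeze_zero (fun i => (hr0 i).le) hr
        ((tendsto_one_div_add_atTop_nhds_zero_nat (𝕜 := ℝ)).comp hrank)
    have hcmem : ∀ i, c i ∈ W i := fun i => hcW i <| by
      simpa [((hd.eq_iff (c i) (c i)).1 rfl).1] using (hr0 i).le
    obtain ⟨x, hx, hxO⟩ := exists_limit_of_nested_balls hd hc ht hrlim
      fun i p hip => hcU i (hWU (i + 1) (hW (Nat.succ_le_of_lt hip) (hcmem p)))
    refine ⟨x, Set.mem_iInter.2 fun i => hWU i (hcW i (hx i)), fun O hO hxO' => ?_⟩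
    obtain ⟨i, hi⟩ := hxO O hO hxO'
    exact ⟨i + 1, (hcU i).trans hi⟩

theorem theorem3p4 {E : Type*} [TopologicalSpace E] (hE : IsQuasiPolishSpace E) :
    IsConvergentApproximationSpace E := by
  obtain ⟨hsc, d, hd, hc, ht⟩ := hE
  set B := TopologicalSpace.countableBasis E
  have hB : TopologicalSpace.IsTopologicalBasis B := TopologicalSpace.isBasis_countableBasis E
  obtain ⟨f, hf⟩ := Set.countable_iff_exists_injOn.1 (TopologicalSpace.countable_countableBasis E)
  have hconv : ∀ U : ℕ → Set E, (∀ i, U i ∈ B) →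
      (∀ i, ∃ W ∈ B, W ⊆ U i ∧ IsRankedApproximation d f W (U (i + 1))) →
      ∃ x ∈ ⋂ i, U i, ∀ O : Set E, IsOpen O → x ∈ O → ∃ i, U i ⊆ O := by
    intro U _ hU
    choose W hWB hWU hR using hU
    exact exists_limit_of_rankedApproximation_chain hd hc ht hf hWB hWU hR
  refine ⟨B, fun U V => ∃ W ∈ B, W ⊆ U ∧ IsRankedApproximation d f W V,
    { isBasis := hB
      subset := fun U _ V _ ⟨W, _, hWU, hWV⟩ => hWV.subset.trans hWU
      mono_left := fun U _ V _ T _ hUT ⟨W, hW, hWU, hWV⟩ => ⟨W, hW, hWU.trans hUT, hWV⟩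
      exists_rel := fun U hU x hx => ?_
      nonempty_iInter := fun U hUB hU => ?_
      convergent := hconv }⟩
  · obtain ⟨V, hV, hxV, hUV⟩ := exists_isRankedApproximation hd ht hB f hU hx
    exact ⟨V, hV, hxV, U, hU, subset_rfl, hUV⟩
  · obtain ⟨x, hx, -⟩ := hconv U hUB hU
    exact ⟨x, hx⟩
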